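/- Let $d$ be a positive integer, let $E$ be a complex separable Hilbert space, and let $\Omega\subseteq\mathbb C^d$ be a connected open set containing $0$. Let $n\ge 0$ be an integer, let $C_\alpha$ ($\alpha\in\mathbb N^d$) and $D_\alpha$ ($\alpha\in\mathbb N^d$, $|\alpha|=\alpha_1+\dots+\alpha_d\le n$) be bounded positive invertible operators on $E$, and let $\mathcal H(\kappa)$ and $\mathcal H(\tilde\kappa)$ be the reproducing kernel Hilbert spaces of $E$-valued holomorphic functions on $\Omega$ with reproducing kernels $$\kappa(z,w)=\sum_{\alpha\in\mathbb N^d} C_\alpha z^\alpha\bar w^\alpha,\qquad \tilde\kappa(z,w)=\sum_{|\alpha|\le n} D_\alpha z^\alpha\bar w^\alpha+\sum_{|\alpha|\ge n+1} C_\alpha z^\alpha\bar w^\alpha\qquad(z,w\in\Omega).$$ Here the series for $\kappa(z,w)$ is assumed to converge in the strong operator topology for all $z,w\in\Omega$. On either space, $\mathscr M_z=(\mathscr M_{z_1},\dots,\mathscr M_{z_d})$ denotes the tuple of operators of multiplication by the coordinate functions, $(\mathscr M_{z_j}f)(z)=z_jf(z)$; it is said to be bounded on the space if every $\mathscr M_{z_j}$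 maps the space into itself and is bounded there. Suppose that $\mathscr M_z$ is bounded on $\mathcal H(\kappa)$. Then: (i) $\mathscr M_z$ is bounded on $\mathcal H(\tilde\kappa)$; (ii) $\mathscr M_z$ on $\mathcal H(\kappa)$ is similar to $\mathscr M_z$ on $\mathcal H(\tilde\kappa)$, i.e. there is a bounded linear bijection $X:\mathcal H(\kappa)\to\mathcal H(\tilde\kappa)$ with bounded inverse such that $X\mathscr M_{z_j}=\mathscr M_{z_j}X$ for all $j=1,\dots,d$. -/

import Mathlib

open scoped ComplexConjugate

namespace DiagKernel

/-- The total degree `|α| = α₁ + ⋯ + α_d` of a multi-index. -/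
def degree {d : ℕ} (α : Fin d → ℕ) : ℕ := ∑ i, α i

/-- The monomial `z^α = z₁^α₁ ⋯ z_d^α_d`. -/
def monom {d : ℕ} (z : Fin d → ℂ) (α : Fin d → ℕ) : ℂ := ∏ i, z i ^ α i

/-- A bounded positive operator on `E` with a bounded inverse. -/
def PosInvertible {E : Type*} [NormedAddCommGroup E] [InnerProductSpace ℂ E]
    (T : E →L[ℂ] E) : Prop :=
  T.IsPositive ∧ IsUnit T

/-- `κ` is the diagonal kernel on `Ω` with coefficients `C`, that is
`κ(z, w) = ∑_α C_α z^α \bar w^α` for all `z, w ∈ Ω`, the (unconditional) sum being taken in the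
strong operator topology. -/
def HasDiagonalExpansion {d : ℕ} {Ω : Set (Fin d → ℂ)} {E : Type*} [NormedAddCommGroup E]
    [InnerProductSpace ℂ E] (κ : Matrix Ω Ω (E →L[ℂ] E)) (C : (Fin d → ℕ) → E →L[ℂ] E) : Prop :=
  ∀ (z w : Ω) (v : E),
    HasSum (fun α : Fin d → ℕ => (monom z.1 α * conj (monom w.1 α)) • C α v) (κ z w v)

/-- The coefficients `D_α` for `|α| ≤ n` and `C_α` for `|α| ≥ n + 1`. -/
def perturb {d : ℕ} {E : Type*} [NormedAddCommGroup E] [InnerProductSpace ℂ E] (n : ℕ)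
    (C D : (Fin d → ℕ) → E →L[ℂ] E) (α : Fin d → ℕ) : E →L[ℂ] E :=
  if degree α ≤ n then D α else C α

/-- The bounded operators `M_1, …, M_d` on the reproducing kernel Hilbert space `H` of `E`-valued
functions on `Ω` are the multiplications by the coordinate functions,
`(M_j f)(z) = z_j f(z)`. (Such operators are unique, as elements of `H` are determined by their
values.) -/
def IsCoordMul {d : ℕ} {Ω : Set (Fin d → ℂ)} {E : Type*} [NormedAddCommGroup E]
    [InnerProductSpace ℂ E] {H : Type*} [NormedAddCommGroup H] [InnerProductSpace ℂ H]
    [RKHS ℂ H Ω E] (M : Fin d → H →L[ℂ] H) : Prop :=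
  ∀ (j : Fin d) (f : H) (z : Ω), M j f z = z.1 j • f z

/-- The tuple `M_z` is bounded on `H`: each `f ↦ z_j f` maps `H` into `H` and is a bounded
operator there. -/
def CoordMulBounded {d : ℕ} {Ω : Set (Fin d → ℂ)} {E : Type*} [NormedAddCommGroup E]
    [InnerProductSpace ℂ E] (H : Type*) [NormedAddCommGroup H] [InnerProductSpace ℂ H]
    [RKHS ℂ H Ω E] : Prop :=
  ∃ M : Fin d → H →L[ℂ] H, IsCoordMul M

/-- Similarity of two `d`-tuples of bounded operators: one bounded invertible operator `X`
satisfies `X S_j = T_j X` for all `j`. -/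
def TupleSimilar {d : ℕ} {H K : Type*} [NormedAddCommGroup H] [InnerProductSpace ℂ H]
    [NormedAddCommGroup K] [InnerProductSpace ℂ K]
    (S : Fin d → H →L[ℂ] H) (T : Fin d → K →L[ℂ] K) : Prop :=
  ∃ X : H ≃L[ℂ] K, ∀ (j : Fin d) (f : H), X (S j f) = T j (X f)

end DiagKernel

/-!
The spaces `H` and `H'` consist of the same functions, with equivalent norms, and the similarity is
the identity map `f ↦ f`.

Invertible positive operators are comparable: `B ≤ c A` for some constant `c`
(`ContinuousLinearMap.exists_le_smul_of_isPositive_of_isUnit`). The two coefficient families differ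
at finitely many multi-indices only, so one constant serves all of them
(`DiagKernel.exists_forall_le_smul`). For a diagonal kernel,
`‖∑_z k_z v_z‖² = ∑_α ⟪C_α u_α, u_α⟫` with `u_α = ∑_z \bar z^α v_z`
(`DiagKernel.HasDiagonalExpansion.hasSum_norm_kerSum_sq`), hence a comparison of the coefficients
bounds the norms of such combinations in one space by the norms in the other. Kernel combinations
being dense, `k_z v ↦ k'_z v` extends to a bounded operator, whose adjoint is an inclusion of
function spaces (`RKHS.exists_inclusion`, Aronszajn's inclusion theorem). Applied in both
directions, this gives the identification of `H` with `H'`, and it transports the multiplications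
by the coordinate functions.
-/

open scoped InnerProductSpace

/-- A positive invertible operator is bounded below by a positive constant, hence a multiple of it
dominates any self-adjoint operator. -/
theorem ContinuousLinearMap.exists_le_smul_of_isPositive_of_isUnit {E : Type*}
    [NormedAddCommGroup E] [InnerProductSpace ℂ E] [CompleteSpace E] {A B : E →L[ℂ] E}
    (hA : A.IsPositive) (hAu : IsUnit A) (hB : IsSelfAdjoint B) :
    ∃ c : ℝ, 0 ≤ c ∧ B ≤ c • A := by
  rcases subsingleton_or_nontrivial E with hE | hE
  · exact ⟨0, le_rfl, (Subsingleton.elim _ _ : B = (0 : ℝ) • A).le⟩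
  have hA0 : 0 ≤ A := (nonneg_iff_isPositive A).2 hA
  obtain ⟨r, hr, hrA⟩ := (CFC.exists_pos_algebraMap_le_iff hA.isSelfAdjoint).2
    fun x hx ↦ (hAu.isStrictlyPositive hA0).spectrum_pos hx
  refine ⟨‖B‖ / r, by positivity, hB.le_algebraMap_norm_self.trans ?_⟩
  have h := smul_le_smul_of_nonneg_left hrA (show 0 ≤ ‖B‖ / r by positivity)
  rwa [Algebra.algebraMap_eq_smul_one, smul_smul, div_mul_cancel₀ _ hr.ne',
    ← Algebra.algebraMap_eq_smul_one] at h

namespace RKHS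

variable {X V : Type*} [NormedAddCommGroup V] [InnerProductSpace ℂ V] [CompleteSpace V]

/-- The linear map sending a finitely supported family `v` to the combination `∑ x, k_x (v x)` of
kernel functions. -/
noncomputable def kerSum (H : Type*) [NormedAddCommGroup H] [InnerProductSpace ℂ H]
    [CompleteSpace H] [RKHS ℂ H X V] : (X →₀ V) →ₗ[ℂ] H :=
  Finsupp.lsum ℂ fun x ↦ (kerFun H x).toLinearMap

variable {H : Type*} [NormedAddCommGroup H] [InnerProductSpace ℂ H] [CompleteSpace H] [RKHS ℂ H X V]
variable {H' : Type*} [NormedAddCommGroup H'] [InnerProductSpace ℂ H'] [CompleteSpace H']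
  [RKHS ℂ H' X V]

theorem kerSum_single (x : X) (v : V) : kerSum H (Finsupp.single x v) = kerFun H x v := by
  simp [kerSum]

theorem denseRange_kerSum : DenseRange (kerSum H : (X →₀ V) → H) := by
  have h : Submodule.span ℂ {kerFun H x v | (x : X) (v : V)} ≤ LinearMap.range (kerSum H) := by
    rw [Submodule.span_le]
    rintro _ ⟨x, v, rfl⟩
    exact ⟨_, kerSum_single x v⟩
  have h' := Submodule.topologicalClosure_mono h
  rw [kerFun_dense, top_le_iff, ← Submodule.dense_iff_topologicalClosure_eq_top] at h'
  exact h'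

/-- **Aronszajn's inclusion theorem**: if combinations of kernel functions are bounded in `H'` by
the same combinations in `H`, then `H'` is contained in `H`, with a bounded inclusion map. -/
theorem exists_inclusion {c : ℝ} (hc : ∀ v : X →₀ V, ‖kerSum H' v‖ ≤ c * ‖kerSum H v‖) :
    ∃ J : H' →L[ℂ] H, ∀ f x, J f x = f x := by
  let T : H →L[ℂ] H' := (kerSum H').extendOfNorm (kerSum H)
  have hT (x : X) (v : V) : T (kerFun H x v) = kerFun H' x v := by
    rw [← kerSum_single, ← kerSum_single]
    exact LinearMap.extendOfNorm_eq denseRange_kerSum ⟨c, hc⟩ _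
  refine ⟨T.adjoint, fun f x ↦ ext_inner_left ℂ fun v ↦ ?_⟩
  rw [← kerFun_inner, ContinuousLinearMap.adjoint_inner_right, hT, kerFun_inner]

end RKHS

namespace DiagKernel

variable {d : ℕ} {E : Type*} [NormedAddCommGroup E] [InnerProductSpace ℂ E]

theorem finite_setOf_degree_le (n : ℕ) : {α : Fin d → ℕ | degree α ≤ n}.Finite := by
  refine (Set.finite_Iic fun _ : Fin d ↦ n).subset fun α hα i ↦ ?_
  exact (Finset.single_le_sum (fun j _ ↦ Nat.zero_le (α j)) (Finset.mem_univ i)).trans hα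

theorem posInvertible_perturb {n : ℕ} {C D : (Fin d → ℕ) → E →L[ℂ] E}
    (hC : ∀ α, PosInvertible (C α)) (hD : ∀ α, degree α ≤ n → PosInvertible (D α))
    (α : Fin d → ℕ) : PosInvertible (perturb n C D α) := by
  unfold perturb
  split_ifs with h
  exacts [hD α h, hC α]

/-- Families of positive invertible operators which differ at finitely many indices only are
comparable with a uniform constant. -/
theorem exists_forall_le_smul [CompleteSpace E] {ι : Type*} {A B : ι → E →L[ℂ] E}
    (hA : ∀ i, PosInvertible (A i)) (hB : ∀ i, PosInvertible (B i))
    (hAB : {i | A i ≠ B i}.Finite) : ∃ c : ℝ, 0 ≤ c ∧ ∀ i, B i ≤ c • A i := by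
  choose c hc0 hc using fun i ↦ ContinuousLinearMap.exists_le_smul_of_isPositive_of_isUnit
    (hA i).1 (hA i).2 (hB i).1.isSelfAdjoint
  have hA0 i : 0 ≤ A i := (ContinuousLinearMap.nonneg_iff_isPositive _).2 (hA i).1
  have hS : 0 ≤ ∑ i ∈ hAB.toFinset, c i := Finset.sum_nonneg fun i _ ↦ hc0 i
  refine ⟨1 + ∑ i ∈ hAB.toFinset, c i, by positivity, fun i ↦ ?_⟩
  by_cases h : A i = B i
  · calc B i = (1 : ℝ) • A i := by rw [one_smul, h]
      _ ≤ _ := smul_le_smul_of_nonneg_right (by linarith) (hA0 i)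
  · have hi : c i ≤ ∑ i ∈ hAB.toFinset, c i :=
      Finset.single_le_sum (f := c) (fun i _ ↦ hc0 i) (by simpa using h)
    exact (hc i).trans (smul_le_smul_of_nonneg_right (by linarith) (hA0 i))

variable [CompleteSpace E] {Ω : Set (Fin d → ℂ)}
variable {H : Type*} [NormedAddCommGroup H] [InnerProductSpace ℂ H] [CompleteSpace H] [RKHS ℂ H Ω E]
variable {H' : Type*} [NormedAddCommGroup H'] [InnerProductSpace ℂ H'] [CompleteSpace H']
  [RKHS ℂ H' Ω E]

/-- The norm of a combination of kernel functions in terms of the coefficients of a diagonal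
kernel. -/
theorem HasDiagonalExpansion.hasSum_norm_kerSum_sq {C : (Fin d → ℕ) → E →L[ℂ] E}
    (hH : HasDiagonalExpansion (RKHS.kernel H) C) (v : Ω →₀ E) :
    HasSum (fun α ↦ (C α).reApplyInnerSelf (∑ z ∈ v.support, conj (monom z.1 α) • v z))
      (‖RKHS.kerSum H v‖ ^ 2) := by
  have key : HasSum (fun α ↦ ∑ z ∈ v.support, ∑ w ∈ v.support,
      ⟪(monom z.1 α * conj (monom w.1 α)) • C α (v w), v z⟫_ℂ)
      (∑ z ∈ v.support, ∑ w ∈ v.support, ⟪RKHS.kernel H z w (v w), v z⟫_ℂ) :=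
    hasSum_sum fun z _ ↦ hasSum_sum fun w _ ↦ (hH z w (v w)).mapL (innerSLFlip ℂ (v z))
  convert Complex.hasSum_re key using 1
  · funext α
    rw [ContinuousLinearMap.reApplyInnerSelf_apply, RCLike.re_eq_complex_re]
    simp only [map_sum, map_smul, map_mul, sum_inner, inner_sum, inner_smul_left, inner_smul_right,
      Complex.conj_conj, Finset.mul_sum, mul_assoc]
  · rw [← inner_self_eq_norm_sq (𝕜 := ℂ)]
    simp only [RKHS.kerSum, Finsupp.lsum_apply, Finsupp.sum, sum_inner, inner_sum,
      RKHS.kernel_inner, ContinuousLinearMap.coe_coe, RCLike.re_eq_complex_re]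

/-- A comparison of the coefficients of diagonal kernels gives an inclusion of the spaces. -/
theorem HasDiagonalExpansion.exists_inclusion {A B : (Fin d → ℕ) → E →L[ℂ] E}
    (hH : HasDiagonalExpansion (RKHS.kernel H) A) (hH' : HasDiagonalExpansion (RKHS.kernel H') B)
    {c : ℝ} (hc0 : 0 ≤ c) (hc : ∀ α, B α ≤ c • A α) :
    ∃ J : H' →L[ℂ] H, ∀ f z, J f z = f z := by
  refine RKHS.exists_inclusion (c := √c) fun v ↦ ?_
  refine le_of_sq_le_sq ?_ (by positivity)
  rw [mul_pow, Real.sq_sqrt hc0]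
  refine hasSum_le (fun α ↦ ?_) (hH'.hasSum_norm_kerSum_sq v)
    ((hH.hasSum_norm_kerSum_sq v).mul_left c)
  generalize ∑ z ∈ v.support, conj (monom z.1 α) • v z = u
  have h := ((ContinuousLinearMap.le_def _ _).1 (hc α)).re_inner_nonneg_left u
  simpa [ContinuousLinearMap.reApplyInnerSelf_apply, inner_sub_left, real_inner_smul_left,
    inner_smul_left_eq_smul] using h

end DiagKernel

theorem proposition3p1 {d : ℕ}
    {E : Type*} [NormedAddCommGroup E] [InnerProductSpace ℂ E] [CompleteSpace E]
    [TopologicalSpace.SeparableSpace E]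
    (Ω : Set (Fin d → ℂ)) (hΩo : IsOpen Ω) (hΩc : IsConnected Ω) (hΩ0 : (0 : Fin d → ℂ) ∈ Ω)
    (n : ℕ) (C D : (Fin d → ℕ) → E →L[ℂ] E)
    (hC : ∀ α, DiagKernel.PosInvertible (C α))
    (hD : ∀ α, DiagKernel.degree α ≤ n → DiagKernel.PosInvertible (D α))
    (H : Type*) [NormedAddCommGroup H] [InnerProductSpace ℂ H] [CompleteSpace H] [RKHS ℂ H Ω E]
    (H' : Type*) [NormedAddCommGroup H'] [InnerProductSpace ℂ H'] [CompleteSpace H']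
    [RKHS ℂ H' Ω E]
    (hH : DiagKernel.HasDiagonalExpansion (RKHS.kernel H) C)
    (hH' : DiagKernel.HasDiagonalExpansion (RKHS.kernel H') (DiagKernel.perturb n C D))
    (hbdd : DiagKernel.CoordMulBounded H) :
    DiagKernel.CoordMulBounded H' ∧
      ∀ (M : Fin d → H →L[ℂ] H) (M' : Fin d → H' →L[ℂ] H'),
        DiagKernel.IsCoordMul M → DiagKernel.IsCoordMul M' → DiagKernel.TupleSimilar M M' := by
  have hP := DiagKernel.posInvertible_perturb hC hD
  have hfin : {α | C α ≠ DiagKernel.perturb n C D α}.Finite := by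
    refine (DiagKernel.finite_setOf_degree_le n).subset fun α hα ↦ ?_
    by_contra h
    exact hα (if_neg h).symm
  obtain ⟨c, hc0, hc⟩ := DiagKernel.exists_forall_le_smul hC hP hfin
  obtain ⟨c', hc0', hc'⟩ :=
    DiagKernel.exists_forall_le_smul hP hC (by simpa only [ne_comm] using hfin)
  obtain ⟨J', hJ'⟩ := hH.exists_inclusion hH' hc0 hc
  obtain ⟨J, hJ⟩ := hH'.exists_inclusion hH hc0' hc'
  refine ⟨?_, fun M M' hM hM' ↦ ?_⟩
  · obtain ⟨M, hM⟩ := hbdd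
    exact ⟨fun j ↦ J ∘L M j ∘L J', fun j f z ↦ by simp [hJ, hM j, hJ']⟩
  · refine ⟨.equivOfInverse J J' (fun f ↦ RKHS.ext fun z ↦ by rw [hJ', hJ])
      (fun f ↦ RKHS.ext fun z ↦ by rw [hJ, hJ']), fun j f ↦ RKHS.ext fun z ↦ ?_⟩
    simp [hJ, hM j, hM' j]
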